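/- Equip $\mathbb R^2$ with the Euclidean betweenness: $x$ is between $a$ and $b$ if $x=(1-\lambda)a+\lambda b$ for some $0\le\lambda\le 1$. A mapping between subsets of $\mathbb R^2$ is called monotone if it preserves betweenness, i.e. whenever $x$ is between $a$ and $b$ (all three in the domain), $f(x)$ is between $f(a)$ and $f(b)$; a monotone isomorphism is a monotone bijection whose inverse is monotone. A homography is a bijection of the real projective plane $\mathbb P^2(\mathbb R)$ onto itself that maps lines onto lines; $\mathbb R^2$ is regarded as a subset of $\mathbb P^2(\mathbb R)$ via $x\mapsto[x:1]$. Theorem. Let $G\subseteq\mathbb R^2$ be a convex set and let $f:G\to\mathbb R^2$ be a monotone mapping such that there exist $a,b,c,d\in G$ for which $f(d)$ lies in the interior of the triangle $[f(a),f(b),f(c)]$ (the convex hull of the three points). Then $f$ is the restriction of a unique homography: there is exactly one homography $\varphi$ of $\mathbb P^2(\mathbb R)$ with $\varphi(x)=f(x)$ for all $x\in G$. In affine coordinates, there are $\alpha\in\mathbb R$, $v\in\mathbb R^2$ and an affine mapping $T:\mathbb R^2\to\mathbb R^2$ such that for every $x\in G$ one has $\alpha+(v\,|\,x)\neq 0$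 and $$f(x)=\frac{1}{\alpha+(v\,|\,x)}\,T(x),$$ where $(v\,|\,x)$ is the usual scalar product. In particular, $f$ is a homeomorphism of $G$ onto its image $f(G)$ and, at the same time, a monotone isomorphism of $G$ onto $f(G)$. -/

import Mathlib

open scoped LinearAlgebra.Projectivization

/-- The Euclidean plane `ℝ²`. -/
abbrev Plane : Type := EuclideanSpace ℝ (Fin 2)

/-- The real projective plane: the one-dimensional linear subspaces of `ℝ² × ℝ`. -/
abbrev ProjPlane : Type := ℙ ℝ (Plane × ℝ)

/-- The standard embedding `x ↦ [x : 1]` of the Euclidean plane in the projective plane. -/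
noncomputable def toProj (x : Plane) : ProjPlane :=
  Projectivization.mk ℝ (x, (1 : ℝ)) fun h => one_ne_zero (congrArg Prod.snd h)

/-- A projective line: all points contained in a fixed two-dimensional linear subspace. -/
def IsProjLine (L : Set ProjPlane) : Prop :=
  ∃ W : Submodule ℝ (Plane × ℝ), Module.finrank ℝ W = 2 ∧ L = {p | p.submodule ≤ W}

/-- A homography: a bijection of the projective plane that maps lines onto lines. -/
def IsHomography (φ : ProjPlane → ProjPlane) : Prop :=
  Function.Bijective φ ∧ ∀ L : Set ProjPlane, IsProjLine L → IsProjLine (φ '' L)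

/-- A mapping from a subset of the plane to the plane is monotone if it preserves the (non-strict)
Euclidean betweenness: `Wbtw ℝ a x b` says that `x = (1 - t) a + t b` for some `0 ≤ t ≤ 1`. -/
def BtwMonotone {X : Set Plane} (f : X → Plane) : Prop :=
  ∀ a x b : X, Wbtw ℝ (a : Plane) (x : Plane) (b : Plane) → Wbtw ℝ (f a) (f x) (f b)

/-! In homogeneous coordinates betweenness becomes conic combination, and positive factors are
immaterial. The points a, b, c, together with d as unit point, form a projective frame on the image
side. They also form one on the domain side, with d strictly inside the triangle
(`BtwMonotone.affineIndependent`, `BtwMonotone.coord_pos`). After linear changes of coordinates on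
both sides, the map therefore fixes the rays of the basis vectors and of (1, 1, 1).

The fundamental theorem of projective geometry is then carried out inside one triangle. Crossings of
preserved cevians are fixed, von Staudt's constructions give the rational rays, and order alone,
without continuity, squeezes the real ones (`ConeMonotone.fixesRay`).

For an arbitrary x in G, each line through x and an interior point of the triangle carries a second
interior point. Both are fixed, so the image of x lies on all these lines and is x itself
(`exists_smul_eq_of_coplanar`). Hence f is induced by a linear automorphism, and a similar pencil of
lines gives uniqueness. The denominator has constant sign on the convex set G, so the inverse is
monotone as well. -/

/-! ### Cone-monotone maps and fixed rays -/

/-- `F` maps every conic combination of `u` and `v` to a conic combination of `F u` and `F v`. -/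
def ConeMonotone (F : (Fin 3 → ℝ) → Fin 3 → ℝ) : Prop :=
  ∀ u v w : Fin 3 → ℝ, 0 ≤ u → 0 ≤ v → u ≠ 0 → v ≠ 0 → w ≠ 0 → ∀ r s : ℝ, 0 ≤ r → 0 ≤ s →
    w = r • u + s • v → ∃ r' s' : ℝ, 0 ≤ r' ∧ 0 ≤ s' ∧ F w = r' • F u + s' • F v

/-- `F` maps the vector `(x, y, z)` into the open ray that it spans. -/
def FixesRay (F : (Fin 3 → ℝ) → Fin 3 → ℝ) (x y z : ℝ) : Prop :=
  ∃ k : ℝ, 0 < k ∧ F ![x, y, z] = ![k * x, k * y, k * z]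

theorem vec3_ne_zero {x y z : ℝ} (h : x ≠ 0 ∨ y ≠ 0 ∨ z ≠ 0) : ![x, y, z] ≠ 0 := by
  intro h0
  have h1 := congrFun h0 0
  have h2 := congrFun h0 1
  have h3 := congrFun h0 2
  simp at h1 h2 h3
  tauto

theorem vec3_nonneg {x y z : ℝ} (hx : 0 ≤ x) (hy : 0 ≤ y) (hz : 0 ≤ z) :
    0 ≤ ![x, y, z] := by
  intro i
  fin_cases i <;> simpa

namespace ConeMonotone

variable {F : (Fin 3 → ℝ) → Fin 3 → ℝ}

/-- Points of the segment joining two fixed rays, in coordinates. -/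
theorem exists_coords (hF : ConeMonotone F) {x y z x' y' z' p q t r s : ℝ}
    (h : FixesRay F x y z) (h' : FixesRay F x' y' z')
    (hx : 0 ≤ x) (hy : 0 ≤ y) (hz : 0 ≤ z) (hx' : 0 ≤ x') (hy' : 0 ≤ y') (hz' : 0 ≤ z')
    (hn : x ≠ 0 ∨ y ≠ 0 ∨ z ≠ 0) (hn' : x' ≠ 0 ∨ y' ≠ 0 ∨ z' ≠ 0)
    (hw : p ≠ 0 ∨ q ≠ 0 ∨ t ≠ 0) (hr : 0 ≤ r) (hs : 0 ≤ s)
    (hp : p = r * x + s * x') (hq : q = r * y + s * y') (ht : t = r * z + s * z') :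
    ∃ r' s' : ℝ, 0 ≤ r' ∧ 0 ≤ s' ∧
      F ![p, q, t] = ![r' * x + s' * x', r' * y + s' * y', r' * z + s' * z'] := by
  obtain ⟨k, hk, hk'⟩ := h
  obtain ⟨l, hl, hl'⟩ := h'
  obtain ⟨r', s', h1, h2, h3⟩ := hF _ _ ![p, q, t] (vec3_nonneg hx hy hz) (vec3_nonneg hx' hy' hz')
    (vec3_ne_zero hn) (vec3_ne_zero hn') (vec3_ne_zero hw) r s hr hs
    (by subst hp hq ht; ext i; fin_cases i <;> simp)
  refine ⟨r' * k, s' * l, by positivity, by positivity, ?_⟩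
  rw [h3, hk', hl']
  ext i
  fin_cases i <;> simp <;> ring

/-- Images of points of a segment whose one end is a fixed ray. -/
theorem exists_coords_right (hF : ConeMonotone F) {x y z x' y' z' p q t k s : ℝ}
    (h : FixesRay F x' y' z')
    (hx : 0 ≤ x) (hy : 0 ≤ y) (hz : 0 ≤ z) (hx' : 0 ≤ x') (hy' : 0 ≤ y') (hz' : 0 ≤ z')
    (hn : x ≠ 0 ∨ y ≠ 0 ∨ z ≠ 0) (hn' : x' ≠ 0 ∨ y' ≠ 0 ∨ z' ≠ 0)
    (hw : p ≠ 0 ∨ q ≠ 0 ∨ t ≠ 0) (hk : 0 ≤ k) (hs : 0 ≤ s)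
    (hp : p = k * x + s * x') (hq : q = k * y + s * y') (ht : t = k * z + s * z') :
    ∃ r' s' : ℝ, 0 ≤ r' ∧ 0 ≤ s' ∧
      ∀ i, F ![p, q, t] i = r' * F ![x, y, z] i + s' * ![x', y', z'] i := by
  obtain ⟨l, hl, hl'⟩ := h
  obtain ⟨r', s', h1, h2, h3⟩ := hF _ _ ![p, q, t] (vec3_nonneg hx hy hz) (vec3_nonneg hx' hy' hz')
    (vec3_ne_zero hn) (vec3_ne_zero hn') (vec3_ne_zero hw) k s hk hs
    (by subst hp hq ht; ext i; fin_cases i <;> simp)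
  refine ⟨r', s' * l, by positivity, by positivity, fun i => ?_⟩
  rw [h3, hl']
  fin_cases i <;> simp <;> ring

variable (hF : ConeMonotone F) (h0 : ∀ u, 0 ≤ u → u ≠ 0 → F u ≠ 0)
  (e1 : FixesRay F 1 0 0) (e2 : FixesRay F 0 1 0) (e3 : FixesRay F 0 0 1)

include h0 in
theorem fixesRay_of_eq {x y z k : ℝ} (hx : 0 ≤ x) (hy : 0 ≤ y) (hz : 0 ≤ z)
    (hn : x ≠ 0 ∨ y ≠ 0 ∨ z ≠ 0) (hk : 0 ≤ k) (h : F ![x, y, z] = ![k * x, k * y, k * z]) :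
    FixesRay F x y z := by
  refine ⟨k, hk.lt_of_ne ?_, h⟩
  rintro rfl
  apply h0 _ (vec3_nonneg hx hy hz) (vec3_ne_zero hn)
  rw [h]
  ext i
  fin_cases i <;> simp

include hF h0

/-- Homogeneity of `F` is not assumed; it comes from a conic combination whose two ends coincide. -/
theorem fixesRay_smul {x y z : ℝ} (h : FixesRay F x y z) (hx : 0 ≤ x) (hy : 0 ≤ y) (hz : 0 ≤ z)
    (hn : x ≠ 0 ∨ y ≠ 0 ∨ z ≠ 0) {k : ℝ} (hk : 0 < k) : FixesRay F (k * x) (k * y) (k * z) := by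
  have hw : k * x ≠ 0 ∨ k * y ≠ 0 ∨ k * z ≠ 0 := by simpa [hk.ne'] using hn
  obtain ⟨r, s, hr, hs, h⟩ := hF.exists_coords h h hx hy hz hx hy hz hn hn hw hk.le le_rfl
    (p := k * x) (q := k * y) (t := k * z) (by ring) (by ring) (by ring)
  refine fixesRay_of_eq h0 (by positivity) (by positivity) (by positivity) hw
    (k := (r + s) / k) (by positivity) ?_
  rw [h]
  congr 1
  · field_simp
  congr 1
  · field_simp
  congr 1
  field_simp

section Crossing

variable {x y z : ℝ} (hx : 0 < x) (hy : 0 < y) (hz : 0 < z)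
include hx hy hz

include e2 e3 in
-- The ray of (x, y, z) is the crossing of two cevians: from e₃ to (x, y, 0) and from e₂ to (x, 0,
-- z). Both are preserved, and comparing coordinates leaves a single ray. The two variants below use
-- the other pairs of cevians.
theorem fixesRay_of_sides₁ (h : FixesRay F x y 0) (h' : FixesRay F x 0 z) : FixesRay F x y z := by
  obtain ⟨r, s, hr, hs, h1⟩ := hF.exists_coords h e3 hx.le hy.le le_rfl le_rfl le_rfl zero_le_one
    (.inl hx.ne') (by simp) (p := x) (q := y) (t := z) (.inl hx.ne') zero_le_one hz.le
    (by ring) (by ring) (by ring)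
  obtain ⟨r', s', hr', hs', h2⟩ := hF.exists_coords h' e2 hx.le le_rfl hz.le le_rfl zero_le_one
    le_rfl (.inl hx.ne') (by simp) (p := x) (q := y) (t := z) (.inl hx.ne') zero_le_one hy.le
    (by ring) (by ring) (by ring)
  have h3 := h1.symm.trans h2
  have a0 := congrFun h3 0
  have a2 := congrFun h3 2
  simp [hx.ne'] at a0 a2
  subst a0
  refine fixesRay_of_eq h0 hx.le hy.le hz.le (.inl hx.ne') hr ?_
  rw [h1]; simp [a2]

include e1 e3 in
theorem fixesRay_of_sides₂ (h : FixesRay F x y 0) (h' : FixesRay F 0 y z) : FixesRay F x y z := by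
  obtain ⟨r, s, hr, hs, h1⟩ := hF.exists_coords h e3 hx.le hy.le le_rfl le_rfl le_rfl zero_le_one
    (.inl hx.ne') (by simp) (p := x) (q := y) (t := z) (.inl hx.ne') zero_le_one hz.le
    (by ring) (by ring) (by ring)
  obtain ⟨r', s', hr', hs', h2⟩ := hF.exists_coords h' e1 le_rfl hy.le hz.le zero_le_one le_rfl
    le_rfl (.inr (.inl hy.ne')) (by simp) (p := x) (q := y) (t := z) (.inl hx.ne') zero_le_one hx.le
    (by ring) (by ring) (by ring)
  have h3 := h1.symm.trans h2
  have a1 := congrFun h3 1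
  have a2 := congrFun h3 2
  simp [hy.ne'] at a1 a2
  subst a1
  refine fixesRay_of_eq h0 hx.le hy.le hz.le (.inl hx.ne') hr ?_
  rw [h1]; simp [a2]

include e1 e2 in
theorem fixesRay_of_sides₃ (h : FixesRay F x 0 z) (h' : FixesRay F 0 y z) : FixesRay F x y z := by
  obtain ⟨r, s, hr, hs, h1⟩ := hF.exists_coords h e2 hx.le le_rfl hz.le le_rfl zero_le_one le_rfl
    (.inl hx.ne') (by simp) (p := x) (q := y) (t := z) (.inl hx.ne') zero_le_one hy.le
    (by ring) (by ring) (by ring)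
  obtain ⟨r', s', hr', hs', h2⟩ := hF.exists_coords h' e1 le_rfl hy.le hz.le zero_le_one le_rfl
    le_rfl (.inr (.inl hy.ne')) (by simp) (p := x) (q := y) (t := z) (.inl hx.ne') zero_le_one hx.le
    (by ring) (by ring) (by ring)
  have h3 := h1.symm.trans h2
  have a1 := congrFun h3 1
  have a2 := congrFun h3 2
  simp [hz.ne'] at a1 a2
  subst a2
  refine fixesRay_of_eq h0 hx.le hy.le hz.le (.inl hx.ne') hr ?_
  rw [h1]; simp [a1]

omit h0 in
include e1 e2 e3 in
-- Projection from e₃ to the opposite side. The image of (x, y, 0) stays in the plane of e₁ and e₂.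
-- The fixed ray lies between it and e₃, so its first two coordinates are proportional to x and y.
theorem fixesRay_side₃ (h : FixesRay F x y z) : FixesRay F x y 0 := by
  obtain ⟨k, hk, hk'⟩ := h
  obtain ⟨a, b, ha, hb, h1⟩ := hF.exists_coords e1 e2 zero_le_one le_rfl le_rfl le_rfl zero_le_one
    le_rfl (by simp) (by simp) (p := x) (q := y) (t := 0) (.inl hx.ne') hx.le hy.le
    (by ring) (by ring) (by ring)
  obtain ⟨r, s, hr, hs, h2⟩ := hF.exists_coords_right e3 hx.le hy.le le_rfl le_rfl le_rfl
    zero_le_one (.inl hx.ne') (by simp) (p := x) (q := y) (t := z) (.inl hx.ne') zero_le_one hz.le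
    (by ring) (by ring) (by ring)
  rw [hk', h1] at h2
  have a0 := h2 0
  have a1 := h2 1
  simp at a0 a1
  have hr0 : r ≠ 0 := by rintro rfl; simp [hk.ne', hx.ne'] at a0
  refine ⟨k / r, by positivity, ?_⟩
  rw [h1]
  ext i; fin_cases i <;> simp <;> field_simp <;> linarith

omit h0 in
include e1 e2 e3 in
theorem fixesRay_side₂ (h : FixesRay F x y z) : FixesRay F x 0 z := by
  obtain ⟨k, hk, hk'⟩ := h
  obtain ⟨a, b, ha, hb, h1⟩ := hF.exists_coords e1 e3 zero_le_one le_rfl le_rfl le_rfl le_rfl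
    zero_le_one (by simp) (by simp) (p := x) (q := 0) (t := z) (.inl hx.ne') hx.le hz.le
    (by ring) (by ring) (by ring)
  obtain ⟨r, s, hr, hs, h2⟩ := hF.exists_coords_right e2 hx.le le_rfl hz.le le_rfl zero_le_one
    le_rfl (.inl hx.ne') (by simp) (p := x) (q := y) (t := z) (.inl hx.ne') zero_le_one hy.le
    (by ring) (by ring) (by ring)
  rw [hk', h1] at h2
  have a0 := h2 0
  have a1 := h2 2
  simp at a0 a1
  have hr0 : r ≠ 0 := by rintro rfl; simp [hk.ne', hx.ne'] at a0
  refine ⟨k / r, by positivity, ?_⟩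
  rw [h1]
  ext i; fin_cases i <;> simp <;> field_simp <;> linarith

omit h0 in
include e1 e2 e3 in
theorem fixesRay_side₁ (h : FixesRay F x y z) : FixesRay F 0 y z := by
  obtain ⟨k, hk, hk'⟩ := h
  obtain ⟨a, b, ha, hb, h1⟩ := hF.exists_coords e2 e3 le_rfl zero_le_one le_rfl le_rfl le_rfl
    zero_le_one (by simp) (by simp) (p := 0) (q := y) (t := z) (.inr (.inl hy.ne')) hy.le hz.le
    (by ring) (by ring) (by ring)
  obtain ⟨r, s, hr, hs, h2⟩ := hF.exists_coords_right e1 le_rfl hy.le hz.le zero_le_one le_rfl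
    le_rfl (.inr (.inl hy.ne')) (by simp) (p := x) (q := y) (t := z) (.inl hx.ne') zero_le_one hx.le
    (by ring) (by ring) (by ring)
  rw [hk', h1] at h2
  have a0 := h2 1
  have a1 := h2 2
  simp at a0 a1
  have hr0 : r ≠ 0 := by rintro rfl; simp [hk.ne', hy.ne'] at a0
  refine ⟨k / r, by positivity, ?_⟩
  rw [h1]
  ext i; fin_cases i <;> simp <;> field_simp <;> linarith

end Crossing

/-! ### Von Staudt arithmetic on one side of the triangle -/

include e1 e2 e3

variable (h1 : FixesRay F 1 1 1)
include h1

theorem fixesRay_zero_one {t : ℝ} (ht : 0 < t) (h : FixesRay F 1 0 t) : FixesRay F 0 1 t :=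
  hF.fixesRay_side₁ e1 e2 e3 one_pos one_pos ht <|
    hF.fixesRay_of_sides₁ h0 e2 e3 one_pos one_pos ht
      (hF.fixesRay_side₃ e1 e2 e3 one_pos one_pos one_pos h1) h

/-- Von Staudt addition: (1, 1, t + u) is the crossing of the segment from (1, 0, t) to (0, 1, u)
with the cevian from (1, 1, 0) to e₃. It is then projected from e₂. -/
theorem fixesRay_add {t u : ℝ} (ht : 0 < t) (hu : 0 < u) (h : FixesRay F 1 0 t)
    (h' : FixesRay F 1 0 u) : FixesRay F 1 0 (t + u) := by
  have h'' := hF.fixesRay_zero_one h0 e1 e2 e3 h1 hu h'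
  have h110 := hF.fixesRay_side₃ e1 e2 e3 one_pos one_pos one_pos h1
  refine hF.fixesRay_side₂ e1 e2 e3 one_pos one_pos (by positivity) ?_
  obtain ⟨r, s, hr, hs, h1⟩ := hF.exists_coords h h'' zero_le_one le_rfl ht.le le_rfl zero_le_one
    hu.le (by simp) (by simp) (p := 1) (q := 1) (t := t + u) (by simp) zero_le_one zero_le_one
    (by ring) (by ring) (by ring)
  obtain ⟨r', s', hr', hs', h2⟩ := hF.exists_coords h110 e3 zero_le_one zero_le_one le_rfl le_rfl
    le_rfl zero_le_one (by simp) (by simp) (p := 1) (q := 1) (t := t + u) (by simp) zero_le_one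
    (add_pos ht hu).le (by ring) (by ring) (by ring)
  have h3 := h1.symm.trans h2
  have a0 := congrFun h3 0
  have a1 := congrFun h3 1
  simp at a0 a1
  subst a0 a1
  refine fixesRay_of_eq h0 zero_le_one zero_le_one (by positivity) (by simp) hr ?_
  rw [h1]; simp [mul_add]

theorem fixesRay_nat (n : ℕ) : FixesRay F 1 0 (n + 1) := by
  have h101 := hF.fixesRay_side₂ e1 e2 e3 one_pos one_pos one_pos h1
  induction n with
  | zero => simpa using h101
  | succ n ih =>
    push_cast
    exact hF.fixesRay_add h0 e1 e2 e3 h1 (by positivity) one_pos ih h101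

theorem fixesRay_rat {q : ℚ} (hq : 0 < q) : FixesRay F 1 0 q := by
  obtain ⟨m, hm⟩ : ∃ m : ℕ, q.num = m + 1 := ⟨(q.num - 1).toNat, by
    have := Rat.num_pos.2 hq
    omega⟩
  obtain ⟨n, hn⟩ : ∃ n : ℕ, q.den = n + 1 := ⟨q.den - 1, by have := q.den_pos; omega⟩
  have hn0 : (0 : ℝ) < n + 1 := by positivity
  have hm0 : (0 : ℝ) < m + 1 := by positivity
  have h101 := hF.fixesRay_side₂ e1 e2 e3 one_pos one_pos one_pos h1
  -- Division by n + 1: (n+1, 0, n+1) and (0, 1, n+1) cross in (n+1, 1, n+1), which projects to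
  -- (n+1, 1, 0). Crossing with (0, 1, m+1) gives (n+1, 1, m+1), hence (n+1, 0, m+1).
  have hn1 : FixesRay F ((n : ℝ) + 1) 0 (n + 1) := by
    simpa using hF.fixesRay_smul h0 h101 zero_le_one le_rfl zero_le_one (by simp) hn0
  have hn2 := hF.fixesRay_zero_one h0 e1 e2 e3 h1 hn0 (hF.fixesRay_nat h0 e1 e2 e3 h1 n)
  have hm2 := hF.fixesRay_zero_one h0 e1 e2 e3 h1 hm0 (hF.fixesRay_nat h0 e1 e2 e3 h1 m)
  have h3 := hF.fixesRay_side₃ e1 e2 e3 hn0 one_pos hn0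
    (hF.fixesRay_of_sides₃ h0 e1 e2 hn0 one_pos hn0 hn1 hn2)
  have h4 := hF.fixesRay_side₂ e1 e2 e3 hn0 one_pos hm0
    (hF.fixesRay_of_sides₂ h0 e1 e3 hn0 one_pos hm0 h3 hm2)
  have h5 := hF.fixesRay_smul h0 h4 hn0.le le_rfl hm0.le (.inl hn0.ne') (inv_pos.2 hn0)
  have : (q : ℝ) = (n + 1 : ℝ)⁻¹ * (m + 1) := by
    rw [Rat.cast_def, hm, hn]
    push_cast
    field_simp
  rw [this]
  simpa [hn0.ne'] using h5

theorem fixesRay_real {t : ℝ} (ht : 0 < t) : FixesRay F 1 0 t := by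
  -- The ray of slope t lies between the rational rays of slopes q and r, which are fixed, so the
  -- slope of its image is also between q and r.
  have key : ∀ q r : ℚ, 0 < q → (q : ℝ) < t → t < r → ∃ p : ℝ, 0 ≤ p ∧ F ![1, 0, t] 0 = p ∧
      F ![1, 0, t] 1 = 0 ∧ p * q ≤ F ![1, 0, t] 2 ∧ F ![1, 0, t] 2 ≤ p * r := by
    intro q r hq hqt htr
    have hq' : (0 : ℝ) < q := by exact_mod_cast hq
    have hqr : (0 : ℝ) < r - q := by linarith
    have hr' : (0 : ℝ) < r := by linarith
    obtain ⟨a, b, ha, hb, h⟩ := hF.exists_coords (hF.fixesRay_rat h0 e1 e2 e3 h1 hq)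
      (hF.fixesRay_rat h0 e1 e2 e3 h1 (q := r) (by exact_mod_cast hr'))
      zero_le_one le_rfl hq'.le zero_le_one le_rfl hr'.le (by simp) (by simp)
      (p := 1) (q := 0) (t := t) (by simp) (r := (r - t) / (r - q)) (s := (t - q) / (r - q))
      (div_nonneg (by linarith) hqr.le) (div_nonneg (by linarith) hqr.le)
      (by field_simp; ring) (by ring) (by field_simp; ring)
    rw [h]
    refine ⟨a + b, by positivity, by simp, by simp, ?_, ?_⟩ <;> simp <;> nlinarith
  obtain ⟨q₀, hq₀, hq₀'⟩ := exists_rat_btwn ht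
  obtain ⟨r₀, hr₀, -⟩ := exists_rat_btwn (lt_add_one t)
  have hq₀p : 0 < q₀ := by exact_mod_cast hq₀
  obtain ⟨p, hp, k0, k1, k2, k3⟩ := key q₀ r₀ hq₀p hq₀' hr₀
  have hp0 : p ≠ 0 := by
    rintro rfl
    apply h0 ![1, 0, t] (vec3_nonneg zero_le_one le_rfl ht.le) (vec3_ne_zero (by simp))
    ext i; fin_cases i
    · exact k0
    · exact k1
    · simp at k2 k3 ⊢; linarith
  have hpp : 0 < p := hp.lt_of_ne' hp0
  have hz : F ![1, 0, t] 2 = p * t := by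
    rcases lt_trichotomy (F ![1, 0, t] 2 / p) t with h | h | h
    · obtain ⟨q, hq, hq'⟩ := exists_rat_btwn (max_lt h ht)
      obtain ⟨p', -, l0, -, l2, -⟩ := key q r₀
        (by exact_mod_cast (le_max_right _ _).trans_lt hq) hq' hr₀
      have := (le_max_left _ _).trans_lt hq
      rw [div_lt_iff₀ hpp] at this
      rw [← l0, k0] at l2
      linarith
    · exact ((div_eq_iff hpp.ne').1 h).trans (mul_comm _ _)
    · obtain ⟨r, hr, hr'⟩ := exists_rat_btwn h
      obtain ⟨p', -, l0, -, -, l3⟩ := key q₀ r hq₀p hq₀' hr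
      rw [lt_div_iff₀ hpp] at hr'
      rw [← l0, k0] at l3
      linarith
  refine ⟨p, hpp, ?_⟩
  ext i; fin_cases i
  · simpa using k0
  · simpa using k1
  · simpa using hz

/-- The fundamental step: a cone-monotone map fixing the rays of the standard projective frame
fixes all positive rays. -/
theorem fixesRay {x y z : ℝ} (hx : 0 < x) (hy : 0 < y) (hz : 0 < z) : FixesRay F x y z := by
  have hxz := hF.fixesRay_smul h0 (hF.fixesRay_real h0 e1 e2 e3 h1 (div_pos hz hx))
    zero_le_one le_rfl (by positivity) (by simp) hx
  have hyz := hF.fixesRay_smul h0 (hF.fixesRay_zero_one h0 e1 e2 e3 h1 (div_pos hz hy)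
    (hF.fixesRay_real h0 e1 e2 e3 h1 (div_pos hz hy))) le_rfl zero_le_one (by positivity)
    (by simp) hy
  rw [mul_one, mul_zero, mul_div_cancel₀ _ hx.ne'] at hxz
  rw [mul_one, mul_zero, mul_div_cancel₀ _ hy.ne'] at hyz
  exact hF.fixesRay_of_sides₃ h0 e1 e2 hx hy hz hxz hyz

end ConeMonotone

/-! ### Coplanarity and homogeneous coordinates -/

/-- A vector of `ℝ³` that is coplanar with `ξ` and every positive vector is a multiple of `ξ`. -/
theorem exists_smul_eq_of_coplanar {X ξ : Fin 3 → ℝ} (hX : X ≠ 0) (hξ : ξ ≠ 0)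
    (h : ∀ u : Fin 3 → ℝ, (∀ i, 0 < u i) →
      ∃ r s t : ℝ, (r ≠ 0 ∨ t ≠ 0) ∧ r • X = s • u + t • ξ) :
    ∃ k : ℝ, k ≠ 0 ∧ X = k • ξ := by
  -- The expression is det(u, X, ξ), the pairing of u with X × ξ. Since positive vectors span the
  -- space, X × ξ = 0.
  have key : ∀ x y z : ℝ, 0 < x → 0 < y → 0 < z →
      x * (X 1 * ξ 2 - X 2 * ξ 1) + y * (X 2 * ξ 0 - X 0 * ξ 2) + z * (X 0 * ξ 1 - X 1 * ξ 0)
        = 0 := by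
    intro x y z hx hy hz
    obtain ⟨r, s, t, hrt, e⟩ := h ![x, y, z] (by intro i; fin_cases i <;> simpa)
    have a0 := congrFun e 0
    have a1 := congrFun e 1
    have a2 := congrFun e 2
    simp at a0 a1 a2
    rcases hrt with hr | ht
    · apply (mul_eq_zero.1 _).resolve_left hr
      linear_combination (y * ξ 2 * -1 + z * ξ 1) * a0 + (x * ξ 2 - z * ξ 0) * a1 +
        (-x * ξ 1 + y * ξ 0) * a2
    · apply (mul_eq_zero.1 _).resolve_left ht
      linear_combination (y * X 2 * -1 + z * X 1) * a0 + (x * X 2 - z * X 0) * a1 +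
        (-x * X 1 + y * X 0) * a2
  have c := key 1 1 1 one_pos one_pos one_pos
  have c0 := key 2 1 1 two_pos one_pos one_pos
  have c1 := key 1 2 1 one_pos two_pos one_pos
  have c2 := key 1 1 2 one_pos one_pos two_pos
  have d0 : X 1 * ξ 2 = X 2 * ξ 1 := by linarith
  have d1 : X 2 * ξ 0 = X 0 * ξ 2 := by linarith
  have d2 : X 0 * ξ 1 = X 1 * ξ 0 := by linarith
  obtain ⟨i, hi⟩ := Function.ne_iff.1 hξ
  have e : X = (X i / ξ i) • ξ := by
    simp only [Pi.zero_apply] at hi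
    ext j
    simp only [Pi.smul_apply, smul_eq_mul]
    field_simp
    fin_cases i <;> fin_cases j <;> simp at hi ⊢ <;> linarith
  refine ⟨X i / ξ i, fun h0 => hX ?_, e⟩
  rw [e, h0, zero_smul]

/-- The vector of homogeneous coordinates `(x, 1)` of a point `x` of the plane. -/
def homVec (x : Plane) : Plane × ℝ := (x, 1)

theorem homVec_ne_zero (x : Plane) : homVec x ≠ 0 := fun h => one_ne_zero (congrArg Prod.snd h)

theorem smul_homVec_inj {x y : Plane} {k l : ℝ} (hk : k ≠ 0)
    (h : k • homVec x = l • homVec y) : x = y := by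
  have h1 := congrArg Prod.fst h
  have h2 := congrArg Prod.snd h
  simp [homVec] at h1 h2
  subst h2
  exact smul_right_injective _ hk h1

theorem Wbtw.exists_homVec {a x b : Plane} (h : Wbtw ℝ a x b) :
    ∃ r s : ℝ, 0 ≤ r ∧ 0 ≤ s ∧ homVec x = r • homVec a + s • homVec b := by
  obtain ⟨t, ⟨h0, h1⟩, rfl⟩ := h
  refine ⟨1 - t, t, by linarith, h0, ?_⟩
  simp [homVec, AffineMap.lineMap_apply_module]

theorem wbtw_of_smul_homVec {a x b : Plane} {k r s : ℝ} (hk : 0 < k) (hr : 0 ≤ r) (hs : 0 ≤ s)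
    (h : k • homVec x = r • homVec a + s • homVec b) : Wbtw ℝ a x b := by
  have h1 := congrArg Prod.fst h
  have h2 := congrArg Prod.snd h
  simp [homVec] at h1 h2
  refine ⟨s / k, ⟨by positivity, (div_le_one hk).2 (by linarith)⟩, ?_⟩
  rw [AffineMap.lineMap_apply_module]
  have h3 : x = k⁻¹ • (r • a + s • b) := by rw [← h1, inv_smul_smul₀ hk.ne']
  rw [h3, smul_add, smul_smul, smul_smul]
  congr 2 <;> field_simp
  linarith

theorem exists_homVec_of_convex {G : Set Plane} (hG : Convex ℝ G) {x y : Plane} (hx : x ∈ G)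
    (hy : y ∈ G) {r s : ℝ} (hr : 0 ≤ r) (hs : 0 ≤ s) (hrs : 0 < r + s) :
    ∃ z ∈ G, r • homVec x + s • homVec y = (r + s) • homVec z := by
  refine ⟨(r / (r + s)) • x + (s / (r + s)) • y,
    hG hx hy (by positivity) (by positivity) (by field_simp), ?_⟩
  simp only [homVec, smul_add, Prod.smul_mk, Prod.mk_add_mk, smul_smul]
  rw [mul_div_cancel₀ _ hrs.ne', mul_div_cancel₀ _ hrs.ne']
  simp

/-- The vectors of an affine basis of the plane in homogeneous coordinates, with any nonzero
scaling, form a basis. -/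
theorem exists_homBasis (P : AffineBasis (Fin 3) ℝ Plane) (w : Fin 3 → ℝ) (hw : ∀ i, w i ≠ 0) :
    ∃ B : Module.Basis (Fin 3) ℝ (Plane × ℝ), ∀ i, B i = w i • homVec (P i) := by
  have hli : LinearIndependent ℝ (fun i => w i • homVec (P i)) := by
    rw [Fintype.linearIndependent_iff]
    intro g hg i
    have h1 := congrArg Prod.fst hg
    have h2 := congrArg Prod.snd hg
    simp only [Prod.fst_sum, Prod.snd_sum, homVec, Prod.smul_mk, Prod.fst_zero, Prod.snd_zero,
      smul_smul] at h1 h2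
    have := affineIndependent_iff.1 P.ind Finset.univ (fun i => g i * w i) (by simpa using h2)
      h1 i (Finset.mem_univ i)
    exact (mul_eq_zero.1 this).resolve_right (hw i)
  exact ⟨basisOfLinearIndependentOfCardEqFinrank hli (by simp), fun i => by simp⟩

/-! ### Monotone maps and frames -/

section Monotone

variable {G : Set Plane} {f : G → Plane}

theorem BtwMonotone.mem_convexHull (hG : Convex ℝ G) (hf : BtwMonotone f) (S : Set G) {x : G}
    (hx : (x : Plane) ∈ convexHull ℝ ((↑) '' S : Set Plane)) : f x ∈ convexHull ℝ (f '' S) := by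
  have hc : Convex ℝ {y : Plane | ∃ h : y ∈ G, f ⟨y, h⟩ ∈ convexHull ℝ (f '' S)} := by
    rw [convex_iff_segment_subset]
    rintro y ⟨hy, hy'⟩ z ⟨hz, hz'⟩ w hw
    have hwG := hG.segment_subset hy hz hw
    refine ⟨hwG, (convex_convexHull ℝ _).segment_subset hy' hz' ?_⟩
    rw [mem_segment_iff_wbtw] at hw ⊢
    exact hf ⟨y, hy⟩ ⟨w, hwG⟩ ⟨z, hz⟩ hw
  have hs : ((↑) '' S : Set Plane) ⊆ {y | ∃ h : y ∈ G, f ⟨y, h⟩ ∈ convexHull ℝ (f '' S)} := by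
    rintro _ ⟨y, hy, rfl⟩
    exact ⟨y.2, subset_convexHull ℝ _ ⟨y, hy, rfl⟩⟩
  exact (convexHull_min hs hc hx).2

/-- A Radon point of dependent points would be sent into the affine spans of two disjoint parts of
an independent family. -/
theorem BtwMonotone.affineIndependent (hG : Convex ℝ G) (hf : BtwMonotone f) {ι : Type*}
    {p : ι → G} (h : AffineIndependent ℝ (f ∘ p)) :
    AffineIndependent ℝ (fun i => (p i : Plane)) := by
  by_contra hp
  obtain ⟨I, z, hz, hz'⟩ := Convex.radon_partition hp
  have hzG : z ∈ G := by
    refine convexHull_min ?_ hG hz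
    rintro _ ⟨i, -, rfl⟩
    exact (p i).2
  have key : ∀ J : Set ι, z ∈ convexHull ℝ ((fun i => (p i : Plane)) '' J) →
      f ⟨z, hzG⟩ ∈ affineSpan ℝ ((f ∘ p) '' J) := by
    intro J hJ
    apply convexHull_subset_affineSpan
    rw [Set.image_comp]
    apply hf.mem_convexHull hG
    rwa [Set.image_image]
  have := h.affineSpan_disjoint_of_disjoint (s1 := I) (s2 := Iᶜ) disjoint_compl_right
  exact Set.disjoint_left.1 this (key _ hz) (key _ hz')

/-- If some coordinate of d were nonpositive, moving the nonpositive terms to the side of d would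
give a point z common to the hull of the vertices in I and the hull of d with those in J. The sum of
the image coordinates over J is zero on the image of the first hull and positive on that of the
second. -/
theorem BtwMonotone.coord_pos (hG : Convex ℝ G) (hf : BtwMonotone f) {ι : Type*} [Fintype ι]
    {P Q : AffineBasis ι ℝ Plane} {p : ι → G} (hP : ∀ i, P i = p i) (hQ : ∀ i, Q i = f (p i))
    {d : G} (hd : ∀ i, 0 < Q.coord i (f d)) (i : ι) : 0 < P.coord i d := by
  classical
  by_contra! hi
  set t : ι → ℝ := fun i => P.coord i d
  have hsum : ∑ i, t i = 1 := P.sum_coord_apply_eq_one _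
  have hcomb : ∑ i, t i • (p i : Plane) = d := by
    simpa [t, hP] using P.linear_combination_coord_eq_self (d : Plane)
  set I : Finset ι := {i | 0 < t i}
  set J : Finset ι := {i | ¬ 0 < t i}
  have hiJ : i ∈ J := by simpa [J] using hi
  have hIJ : ∑ i ∈ I, t i + ∑ i ∈ J, t i = 1 := by
    rw [← hsum]; exact Finset.sum_filter_add_sum_filter_not _ _ _
  have hIJ' : ∑ i ∈ I, t i • (p i : Plane) + ∑ i ∈ J, t i • (p i : Plane) = d := by
    rw [← hcomb]; exact Finset.sum_filter_add_sum_filter_not _ _ _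
  have hJ : ∑ i ∈ J, t i ≤ 0 := Finset.sum_nonpos fun j hj => by simpa [J] using hj
  set S := ∑ i ∈ I, t i
  have hS : 0 < S := by linarith
  obtain ⟨z, hz⟩ : ∃ z : Plane, z = S⁻¹ • ∑ i ∈ I, t i • (p i : Plane) := ⟨_, rfl⟩
  have hzI : z ∈ convexHull ℝ ((↑) '' (p '' (I : Set ι)) : Set Plane) := by
    have : z = I.centerMass t (fun i => (p i : Plane)) := hz
    rw [this]
    refine I.centerMass_mem_convexHull (fun j hj => ?_) hS
      fun j hj => ⟨p j, ⟨j, hj, rfl⟩, rfl⟩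
    exact (Finset.mem_filter.1 hj).2.le
  have hzJ : z ∈ convexHull ℝ ((↑) '' (insert d (p '' (J : Set ι))) : Set Plane) := by
    have h1 : z = S⁻¹ • (d : Plane) + ∑ j ∈ J, (-(S⁻¹ * t j)) • (p j : Plane) := by
      rw [hz, ← hIJ', smul_add, add_assoc, Finset.smul_sum (s := J), ← Finset.sum_add_distrib]
      simp [smul_smul, neg_smul]
    have h2 : S⁻¹ + ∑ j ∈ J, (-(S⁻¹ * t j)) = 1 := by
      rw [Finset.sum_neg_distrib, ← Finset.mul_sum, eq_sub_of_add_eq' hIJ]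
      field_simp
      ring
    have h3 : ∀ o ∈ J.insertNone, (0 : ℝ) ≤ Option.elim o S⁻¹ (fun j => -(S⁻¹ * t j)) := by
      rintro (_ | j) hj
      · exact (inv_pos.2 hS).le
      · have hj : t j ≤ 0 := by simpa [J] using hj
        have := inv_pos.2 hS
        simp only [Option.elim]
        nlinarith
    rw [h1]
    have := (convex_convexHull ℝ ((↑) '' (insert d (p '' (J : Set ι))) : Set Plane)).sum_mem
      (t := J.insertNone) (w := fun o => Option.elim o S⁻¹ (fun j => -(S⁻¹ * t j)))
      (z := fun o => Option.elim o (d : Plane) (fun j => (p j : Plane))) h3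
      (by rw [Finset.sum_insertNone]; exact h2) (by
        rintro (_ | j) hj
        · exact subset_convexHull ℝ _ ⟨d, by simp, rfl⟩
        · exact subset_convexHull ℝ _ ⟨p j, Or.inr ⟨j, by simpa using hj, rfl⟩, rfl⟩)
    rw [Finset.sum_insertNone] at this
    exact this
  have hzG : z ∈ G := by
    refine convexHull_min ?_ hG hzI
    rintro _ ⟨y, -, rfl⟩
    exact y.2
  have hfI := hf.mem_convexHull hG _ (x := ⟨z, hzG⟩) hzI
  have hfJ := hf.mem_convexHull hG _ (x := ⟨z, hzG⟩) hzJ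
  set φ : Plane →ᵃ[ℝ] ℝ := ∑ j ∈ J, Q.coord j with hφ
  have hφa : ∀ y, φ y = ∑ j ∈ J, Q.coord j y := fun y => by
    rw [hφ]
    induction J using Finset.induction_on with
    | empty => simp
    | insert a s ha ih => rw [Finset.sum_insert ha, Finset.sum_insert ha, AffineMap.coe_add,
        Pi.add_apply, ih]
  have e1 : φ (f ⟨z, hzG⟩) ∈ ({0} : Set ℝ) := by
    refine convexHull_min (t := φ ⁻¹' {0}) ?_ ((convex_singleton 0).affine_preimage φ) hfI
    rintro _ ⟨_, ⟨k, hk, rfl⟩, rfl⟩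
    rw [Set.mem_preimage, Set.mem_singleton_iff, hφa]
    refine Finset.sum_eq_zero fun j hj => ?_
    rw [← hQ, AffineBasis.coord_apply, if_neg]
    rintro rfl
    exact (Finset.mem_filter.1 hj).2 (Finset.mem_filter.1 hk).2
  have e2 : φ (f ⟨z, hzG⟩) ∈ Set.Ioi (0 : ℝ) := by
    refine convexHull_min (t := φ ⁻¹' Set.Ioi 0) ?_ ((convex_Ioi 0).affine_preimage φ) hfJ
    rintro _ ⟨y, hy, rfl⟩
    rw [Set.mem_preimage, Set.mem_Ioi, hφa]
    rcases hy with rfl | ⟨k, hk, rfl⟩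
    · exact Finset.sum_pos (fun j _ => hd j) ⟨i, hiJ⟩
    · rw [← hQ]
      simp only [AffineBasis.coord_apply]
      rw [Finset.sum_ite_eq_of_mem' _ _ _ (by simpa using hk)]
      exact one_pos
  exact (Set.mem_Ioi.1 e2).ne' (Set.mem_singleton_iff.1 e1)

/-- Corresponding projective frames of the domain and the codomain. -/
theorem BtwMonotone.exists_frames (hG : Convex ℝ G) (hf : BtwMonotone f)
    (hint : ∃ a b c d : G, f d ∈ interior (convexHull ℝ {f a, f b, f c})) :
    ∃ B B' : Module.Basis (Fin 3) ℝ (Plane × ℝ),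
      (∀ i, ∃ x : G, ∃ k k' : ℝ, 0 < k ∧ 0 < k' ∧ B i = k • homVec x ∧ B' i = k' • homVec (f x)) ∧
      ∃ d : G, ∑ i, B i = homVec d ∧ ∑ i, B' i = homVec (f d) := by
  obtain ⟨a, b, c, d, hd⟩ := hint
  set p : Fin 3 → G := ![a, b, c]
  have hr : Set.range (f ∘ p) = {f a, f b, f c} := by
    ext y
    simp [p, Fin.exists_fin_succ, eq_comm]
  rw [← hr] at hd
  have hcard : Fintype.card (Fin 3) = Module.finrank ℝ Plane + 1 := by simp
  have hspan : affineSpan ℝ (Set.range (f ∘ p)) = ⊤ :=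
    interior_convexHull_nonempty_iff_affineSpan_eq_top.1 ⟨_, hd⟩
  have hind : AffineIndependent ℝ (f ∘ p) :=
    (affineIndependent_iff_finrank_vectorSpan_eq ℝ _ hcard).2 <| by
      rw [AffineSubspace.vectorSpan_eq_top_of_affineSpan_eq_top ℝ Plane Plane hspan, finrank_top]
  have hind' := hf.affineIndependent hG hind
  have hspan' := hind'.affineSpan_eq_top_iff_card_eq_finrank_add_one.2 hcard
  set Q : AffineBasis (Fin 3) ℝ Plane := ⟨_, hind, hspan⟩
  set P : AffineBasis (Fin 3) ℝ Plane := ⟨_, hind', hspan'⟩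
  have hQ : ∀ i, Q i = f (p i) := fun i => rfl
  have hP : ∀ i, P i = p i := fun i => rfl
  have hdQ : ∀ i, 0 < Q.coord i (f d) := by
    have : f d ∈ interior (convexHull ℝ (Set.range Q)) := hd
    rwa [Q.interior_convexHull] at this
  have hdP := hf.coord_pos hG hP hQ hdQ
  -- Scaling by the barycentric coordinates of d makes it the unit point of the frame; likewise for
  -- f d.
  obtain ⟨B, hB⟩ := exists_homBasis P (fun i => P.coord i d) fun i => (hdP i).ne'
  obtain ⟨B', hB'⟩ := exists_homBasis Q (fun i => Q.coord i (f d)) fun i => (hdQ i).ne'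
  have hsum : ∀ (R : AffineBasis (Fin 3) ℝ Plane) (x : Plane),
      ∑ i, R.coord i x • homVec (R i) = homVec x := by
    intro R x
    refine Prod.ext ?_ ?_
    · simp [Prod.fst_sum, homVec]
    · simp [Prod.snd_sum, homVec]
  refine ⟨B, B', fun i => ⟨p i, _, _, hdP i, hdQ i, hB i, hB' i⟩, d, ?_, ?_⟩
  · simp only [hB, hsum]
  · simp only [hB', hsum]

end Monotone

/-! ### From the triangle to all of G -/

theorem exists_pos_smul_add {u : Fin 3 → ℝ} (hu : ∀ i, 0 < u i) (ξ : Fin 3 → ℝ) :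
    ∃ N : ℝ, 0 < N ∧ ∀ i, 0 < (N • u + ξ) i := by
  refine ⟨∑ i, |ξ i| / u i + 1, add_pos_of_nonneg_of_pos
    (Finset.sum_nonneg fun i _ => div_nonneg (abs_nonneg _) (hu i).le) one_pos, fun i => ?_⟩
  have h1 := (Finset.single_le_sum (f := fun i => |ξ i| / u i)
    (fun i _ => div_nonneg (abs_nonneg _) (hu i).le) (Finset.mem_univ i)).trans_lt (lt_add_one _)
  rw [div_lt_iff₀ (hu i)] at h1
  have := neg_abs_le (ξ i)
  simp only [Pi.add_apply, Pi.smul_apply, smul_eq_mul]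
  linarith

/-- The cone over `G` contains all nonzero vectors with nonnegative coordinates in `B`. -/
def IsFrameOf (G : Set Plane) (B : Module.Basis (Fin 3) ℝ (Plane × ℝ)) : Prop :=
  ∀ u : Fin 3 → ℝ, 0 ≤ u → u ≠ 0 → ∃ x : G, ∃ k : ℝ, 0 < k ∧ B.equivFun.symm u = k • homVec x

theorem isFrameOf_of_basis {G : Set Plane} (hG : Convex ℝ G)
    {B : Module.Basis (Fin 3) ℝ (Plane × ℝ)}
    (h : ∀ i, ∃ x : G, ∃ k : ℝ, 0 < k ∧ B i = k • homVec x) : IsFrameOf G B := by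
  have key : ∀ s : Finset (Fin 3), ∀ u : Fin 3 → ℝ, 0 ≤ u →
      (∑ i ∈ s, u i • B i = 0) ∨
        ∃ x : G, ∃ k : ℝ, 0 < k ∧ ∑ i ∈ s, u i • B i = k • homVec x := by
    intro s u hu
    induction s using Finset.induction_on with
    | empty => simp
    | insert i s hi ih =>
      rw [Finset.sum_insert hi]
      obtain ⟨y, l, hl, hy⟩ := h i
      rcases (hu i).eq_or_lt with h0 | h0
      · rw [← h0]
        simpa using ih
      · have hpos : 0 < u i * l := mul_pos h0 hl
        right
        rcases ih with ih | ⟨x, k, hk, ih⟩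
        · exact ⟨y, u i * l, hpos, by rw [ih, hy, smul_smul, add_zero]⟩
        · obtain ⟨z, hz, e⟩ := exists_homVec_of_convex hG y.2 x.2 hpos.le hk.le (by positivity)
          exact ⟨⟨z, hz⟩, u i * l + k, by positivity, by rw [ih, hy, smul_smul, e]⟩
  intro u hu hu0
  rcases key Finset.univ u hu with h0 | h0
  · rw [← B.equivFun_symm_apply] at h0
    exact absurd ((LinearEquiv.map_eq_zero_iff _).1 h0) hu0
  · simpa only [B.equivFun_symm_apply] using h0

open Classical in
/-- A mapping of the plane, written in homogeneous coordinates with respect to two frames. -/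
noncomputable def coordMap {G : Set Plane} (f : G → Plane)
    (B B' : Module.Basis (Fin 3) ℝ (Plane × ℝ)) (u : Fin 3 → ℝ) : Fin 3 → ℝ :=
  if h : ∃ x : G, ∃ k : ℝ, 0 < k ∧ B.equivFun.symm u = k • homVec x then
    B'.equivFun (homVec (f h.choose)) else 0

section Monotone

variable {G : Set Plane} {f : G → Plane} {B B' : Module.Basis (Fin 3) ℝ (Plane × ℝ)}

/-- The chosen point is unique because a ray determines its point. The value ignores the factor k,
so `coordMap` is constant on open rays in the cone over G. -/
theorem coordMap_eq {u : Fin 3 → ℝ} {x : G} {k : ℝ} (hk : 0 < k)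
    (h : B.equivFun.symm u = k • homVec x) : coordMap f B B' u = B'.equivFun (homVec (f x)) := by
  have h' : ∃ x : G, ∃ k : ℝ, 0 < k ∧ B.equivFun.symm u = k • homVec x := ⟨x, k, hk, h⟩
  obtain ⟨l, hl, e⟩ := h'.choose_spec
  rw [coordMap, dif_pos h']
  rw [Subtype.ext (smul_homVec_inj hk.ne' (h.symm.trans e))]

theorem BtwMonotone.coneMonotone_coordMap (hf : BtwMonotone f) (hB : IsFrameOf G B) :
    ConeMonotone (coordMap f B B') := by
  intro u v w hu hv hu0 hv0 hw0 r s hr hs e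
  obtain ⟨x, k, hk, hx⟩ := hB u hu hu0
  obtain ⟨y, l, hl, hy⟩ := hB v hv hv0
  obtain ⟨z, m, hm, hz⟩ := hB w (by rw [e]; positivity) hw0
  have hbtw : Wbtw ℝ (x : Plane) z y := by
    refine wbtw_of_smul_homVec hm (mul_nonneg hr hk.le) (mul_nonneg hs hl.le) ?_
    rw [← hz, e, map_add, map_smul, map_smul, hx, hy, smul_smul, smul_smul]
  obtain ⟨r', s', hr', hs', e'⟩ := (hf x z y hbtw).exists_homVec
  refine ⟨r', s', hr', hs', ?_⟩
  rw [coordMap_eq hk hx, coordMap_eq hl hy, coordMap_eq hm hz, e', map_add, map_smul, map_smul]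

/-- A monotone mapping fixes, in suitable coordinates, all positive rays. -/
theorem BtwMonotone.coordMap_eq_smul (hf : BtwMonotone f) (hB : IsFrameOf G B)
    (hi : ∀ i, ∃ x : G, ∃ k k' : ℝ, 0 < k ∧ 0 < k' ∧ B i = k • homVec x ∧ B' i = k' • homVec (f x))
    (hd : ∃ d : G, ∑ i, B i = homVec d ∧ ∑ i, B' i = homVec (f d))
    {u : Fin 3 → ℝ} (hu : ∀ i, 0 < u i) : ∃ k : ℝ, 0 < k ∧ coordMap f B B' u = k • u := by
  have h0 : ∀ u, 0 ≤ u → u ≠ 0 → coordMap f B B' u ≠ 0 := by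
    intro u hu hu0
    obtain ⟨x, k, hk, hx⟩ := hB u hu hu0
    rw [coordMap_eq hk hx]
    simpa using homVec_ne_zero (f x)
  have he : ∀ i, ∃ k : ℝ, 0 < k ∧ coordMap f B B' (Pi.single i 1) = k • Pi.single i 1 := by
    intro i
    obtain ⟨x, k, k', hk, hk', h, h'⟩ := hi i
    refine ⟨k'⁻¹, inv_pos.2 hk', ?_⟩
    rw [coordMap_eq hk (x := x) (by simpa [B.equivFun_symm_apply, Pi.single_apply] using h)]
    rw [← inv_smul_smul₀ hk'.ne' (homVec (f x)), ← h', map_smul]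
    congr 1
    ext j
    simp [Pi.single_apply, eq_comm]
  have h1 : FixesRay (coordMap f B B') 1 1 1 := by
    obtain ⟨d, h, h'⟩ := hd
    refine ⟨1, one_pos, ?_⟩
    rw [coordMap_eq one_pos (x := d) (by
      rw [one_smul, ← h, B.equivFun_symm_apply]; simp [Fin.sum_univ_three]), ← h', map_sum]
    ext j
    fin_cases j <;> simp [Finsupp.single_apply]
  have hfix : ∀ x y z : ℝ, FixesRay (coordMap f B B') x y z ↔
      ∃ k : ℝ, 0 < k ∧ coordMap f B B' ![x, y, z] = k • ![x, y, z] := by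
    intro x y z
    simp [FixesRay]
  have hv : u = ![u 0, u 1, u 2] := by ext i; fin_cases i <;> rfl
  rw [hv, ← hfix]
  refine (hf.coneMonotone_coordMap hB).fixesRay h0 ?_ ?_ ?_ h1 (hu 0) (hu 1) (hu 2)
  · rw [hfix]
    convert he 0 using 5 <;> ext j <;> fin_cases j <;> simp
  · rw [hfix]
    convert he 1 using 5 <;> ext j <;> fin_cases j <;> simp
  · rw [hfix]
    convert he 2 using 5 <;> ext j <;> fin_cases j <;> simp

/-- A monotone mapping with nondegenerate image is given by a linear isomorphism in homogeneous
coordinates. -/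
theorem BtwMonotone.exists_linearEquiv (hG : Convex ℝ G) (hf : BtwMonotone f)
    (hint : ∃ a b c d : G, f d ∈ interior (convexHull ℝ {f a, f b, f c})) :
    (∃ B, IsFrameOf G B) ∧ ∃ M : (Plane × ℝ) ≃ₗ[ℝ] (Plane × ℝ), ∀ x : G,
      ∃ k : ℝ, k ≠ 0 ∧ homVec (f x) = k • M (homVec x) := by
  obtain ⟨B, B', hi, hd⟩ := hf.exists_frames hG hint
  have hB : IsFrameOf G B := isFrameOf_of_basis hG fun i => by
    obtain ⟨x, k, -, hk, -, h, -⟩ := hi i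
    exact ⟨x, k, hk, h⟩
  refine ⟨⟨B, hB⟩, B.equivFun.trans B'.equivFun.symm, fun x => ?_⟩
  obtain ⟨k, hk, e⟩ := exists_smul_eq_of_coplanar (X := B'.equivFun (homVec (f x)))
    (ξ := B.equivFun (homVec x)) (by simpa using homVec_ne_zero (f x))
    (by simpa using homVec_ne_zero (x : Plane)) (fun u hu => by
      set ξ := B.equivFun (homVec x)
      have hu0 : u ≠ 0 := fun h => (hu 0).ne' (congrFun h 0)
      -- For large N the vector N u + ξ is positive too, so the line through u and ξ carries two
      -- fixed rays, with the second between u and ξ.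
      obtain ⟨N, hN, hw⟩ := exists_pos_smul_add hu ξ
      obtain ⟨y, k, hk, hy⟩ := hB u (fun i => (hu i).le) hu0
      obtain ⟨z, l, hl, hz⟩ := hB (N • u + ξ) (fun i => (hw i).le)
        fun h => (hw 0).ne' (congrFun h 0)
      obtain ⟨k', hk', ey⟩ := hf.coordMap_eq_smul hB hi hd hu
      obtain ⟨l', hl', ez⟩ := hf.coordMap_eq_smul hB hi hd hw
      rw [coordMap_eq hk hy] at ey
      rw [coordMap_eq hl hz] at ez
      have hbtw : Wbtw ℝ (y : Plane) z x := by
        refine wbtw_of_smul_homVec hl (mul_nonneg hN.le hk.le) zero_le_one ?_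
        rw [← hz, map_add, map_smul, hy, smul_smul, one_smul, LinearEquiv.symm_apply_apply]
      obtain ⟨r, s, hr, hs, e⟩ := (hf y z x hbtw).exists_homVec
      have e' := congrArg B'.equivFun e
      rw [map_add, map_smul, map_smul, ey, ez] at e'
      -- The coefficient s may vanish, but l' is positive, so the relation still forces coplanarity.
      refine ⟨s, l' * N - r * k', l', .inr hl'.ne', ?_⟩
      replace e' := sub_eq_of_eq_add' e'
      rw [← e', smul_add, sub_smul, smul_smul, smul_smul]
      abel)
  refine ⟨k, hk, ?_⟩
  rw [← B'.equivFun.symm_apply_apply (homVec (f x)), e, map_smul]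
  rfl

end Monotone

/-! ### Lines and homographies -/

theorem finrank_span_pair {v w : Plane × ℝ} (h : LinearIndependent ℝ ![v, w]) :
    Module.finrank ℝ (Submodule.span ℝ {v, w}) = 2 := by
  have := finrank_span_eq_card h
  rwa [Matrix.range_cons, Matrix.range_cons, Matrix.range_empty, Set.union_empty,
    Set.singleton_union, Fintype.card_fin] at this

theorem mk_submodule_le_iff {v : Plane × ℝ} (hv : v ≠ 0) (W : Submodule ℝ (Plane × ℝ)) :
    (Projectivization.mk ℝ v hv).submodule ≤ W ↔ v ∈ W := by
  rw [Projectivization.submodule_mk, Submodule.span_singleton_le_iff_mem]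

theorem IsProjLine.eq_of_mem_of_mem {L L' : Set ProjPlane} (hL : IsProjLine L)
    (hL' : IsProjLine L') {p q : ProjPlane} (hpq : p ≠ q) (hp : p ∈ L) (hq : q ∈ L) (hp' : p ∈ L')
    (hq' : q ∈ L') : L = L' := by
  have hind : LinearIndependent ℝ ![p.rep, q.rep] := by
    have h := Projectivization.independent_iff.1
      ((Projectivization.independent_pair_iff_ne p q).2 hpq)
    have e : Projectivization.rep ∘ ![p, q] = ![p.rep, q.rep] := by
      funext i
      fin_cases i <;> rfl
    rwa [e] at h
  have key : ∀ W : Submodule ℝ (Plane × ℝ), Module.finrank ℝ W = 2 → p.submodule ≤ W →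
      q.submodule ≤ W → W = Submodule.span ℝ {p.rep, q.rep} := by
    intro W hW h1 h2
    refine (Submodule.eq_of_le_of_finrank_eq ?_ ?_).symm
    · rw [← p.mk_rep, mk_submodule_le_iff] at h1
      rw [← q.mk_rep, mk_submodule_le_iff] at h2
      exact Submodule.span_le.2 (Set.pair_subset h1 h2)
    · rw [hW, finrank_span_pair hind]
  obtain ⟨W, hW, rfl⟩ := hL
  obtain ⟨W', hW', rfl⟩ := hL'
  rw [key W hW hp hq, key W' hW' hp' hq']

theorem isHomography_map (M : (Plane × ℝ) ≃ₗ[ℝ] (Plane × ℝ)) :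
    IsHomography (Projectivization.map (M : (Plane × ℝ) →ₗ[ℝ] (Plane × ℝ)) M.injective) := by
  have hsurj : ∀ q : ProjPlane, ∃ p : ProjPlane,
      Projectivization.map (M : (Plane × ℝ) →ₗ[ℝ] (Plane × ℝ)) M.injective p = q ∧
        ∀ W : Submodule ℝ (Plane × ℝ), p.submodule ≤ W ↔ q.submodule ≤ W.map M.toLinearMap := by
    intro q
    induction q using Projectivization.ind with | h v hv
    refine ⟨.mk ℝ (M.symm v) (by simpa using hv), ?_, fun W => ?_⟩
    · rw [Projectivization.map_mk]
      congr 1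
      simp
    · rw [mk_submodule_le_iff, mk_submodule_le_iff]
      simp only [Submodule.mem_map]
      constructor
      · exact fun h => ⟨_, h, by simp⟩
      · rintro ⟨w, hw, rfl⟩
        simpa using hw
  have hinj := Projectivization.map_injective (M : (Plane × ℝ) →ₗ[ℝ] (Plane × ℝ)) M.injective
  refine ⟨⟨hinj, fun q => (hsurj q).imp fun _ h => h.1⟩, ?_⟩
  rintro _ ⟨W, hW, rfl⟩
  refine ⟨W.map M.toLinearMap, (LinearEquiv.finrank_map_eq M W).trans hW, ?_⟩
  ext q
  obtain ⟨p, rfl, hp⟩ := hsurj q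
  rw [hinj.mem_set_image]
  exact hp W

/-- Two homographies that agree on a set with a frame coincide. -/
theorem IsHomography.eq_of_eqOn {G : Set Plane} {B : Module.Basis (Fin 3) ℝ (Plane × ℝ)}
    (hB : IsFrameOf G B) {φ ψ : ProjPlane → ProjPlane} (hφ : IsHomography φ)
    (hψ : IsHomography ψ) (h : ∀ x : G, φ (toProj x) = ψ (toProj x)) : φ = ψ := by
  funext p
  -- It remains to see that p' = p. A line through p and a point x of the open triangle contains a
  -- second point y of G, so both homographies send it to the same line. Hence p' lies on every such
  -- line.
  obtain ⟨p', hp'⟩ := hψ.1.2 (φ p)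
  rw [← hp']
  congr 1
  induction p using Projectivization.ind with | h m hm
  induction p' using Projectivization.ind with | h m' hm'
  obtain ⟨k, hk, e⟩ := exists_smul_eq_of_coplanar (X := B.equivFun m') (ξ := B.equivFun m)
    (by simpa using hm') (by simpa using hm) (fun u hu => by
      obtain ⟨x, k, hk, hx⟩ := hB u (fun i => (hu i).le) fun h => (hu 0).ne' (congrFun h 0)
      obtain ⟨N, hN, hw⟩ := exists_pos_smul_add hu (B.equivFun m)
      obtain ⟨y, l, hl, hy⟩ := hB _ (fun i => (hw i).le) fun h => (hw 0).ne' (congrFun h 0)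
      rw [map_add, map_smul, LinearEquiv.symm_apply_apply, hx] at hy
      rw [LinearEquiv.symm_apply_eq, map_smul] at hx
      by_cases hind : LinearIndependent ℝ ![homVec (x : Plane), m]
      · set L : Set ProjPlane := {p | p.submodule ≤ Submodule.span ℝ {homVec (x : Plane), m}}
        have hL : IsProjLine L := ⟨_, finrank_span_pair hind, rfl⟩
        have hxW := Submodule.mem_span_of_mem (R := ℝ)
          (show homVec (x : Plane) ∈ ({homVec (x : Plane), m} : Set (Plane × ℝ)) by simp)
        have hmW := Submodule.mem_span_of_mem (R := ℝ)
          (show m ∈ ({homVec (x : Plane), m} : Set (Plane × ℝ)) by simp)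
        have hxL : toProj x ∈ L := (mk_submodule_le_iff _ _).2 hxW
        have hmL : Projectivization.mk ℝ m hm ∈ L := (mk_submodule_le_iff _ _).2 hmW
        have hyL : toProj y ∈ L := by
          refine (mk_submodule_le_iff _ _).2 ?_
          change homVec (y : Plane) ∈ _
          rw [← inv_smul_smul₀ hl.ne' (homVec (y : Plane)), ← hy]
          exact Submodule.smul_mem _ _ (Submodule.add_mem _
            (Submodule.smul_mem _ _ (Submodule.smul_mem _ _ hxW)) hmW)
        have hxy : toProj x ≠ toProj y := by
          intro hxy
          obtain ⟨a, ha⟩ := (Projectivization.mk_eq_mk_iff' ℝ _ _ _ _).1 hxy.symm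
          change a • homVec (x : Plane) = homVec (y : Plane) at ha
          refine (LinearIndependent.pair_iff' (homVec_ne_zero _)).1 hind (l * a - N * k) ?_
          rw [sub_smul, mul_smul, ha, ← hy, smul_smul, add_sub_cancel_left]
        have hLL : φ '' L = ψ '' L := by
          refine (hφ.2 L hL).eq_of_mem_of_mem (hψ.2 L hL) (hφ.1.1.ne hxy) ⟨_, hxL, rfl⟩
            ⟨_, hyL, rfl⟩ ⟨_, hxL, (h x).symm⟩ ⟨_, hyL, (h y).symm⟩
        have hmem : φ (.mk ℝ m hm) ∈ ψ '' L := hLL ▸ ⟨_, hmL, rfl⟩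
        rw [← hp', hψ.1.1.mem_set_image] at hmem
        obtain ⟨a, b, hab⟩ := Submodule.mem_span_pair.1 ((mk_submodule_le_iff _ _).1 hmem)
        refine ⟨1, a * k⁻¹, b, .inl one_ne_zero, ?_⟩
        rw [← hab, hx]
        simp [smul_smul, hk.ne']
      -- Here p is the point x itself, and coplanarity is trivial.
      · rw [LinearIndependent.pair_iff' (homVec_ne_zero _)] at hind
        push Not at hind
        obtain ⟨a, rfl⟩ := hind
        refine ⟨0, a * k⁻¹, -1, .inr (by simp), ?_⟩
        rw [hx]
        simp [smul_smul, hk.ne'])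
  rw [← map_smul] at e
  exact (Projectivization.mk_eq_mk_iff' ℝ _ _ _ _).2 ⟨k, (B.equivFun.injective e).symm⟩

/-! ### Affine form and the inverse map -/

/-- The partially defined mapping of the plane given by a linear mapping in homogeneous
coordinates. -/
noncomputable def homDiv (M : (Plane × ℝ) ≃ₗ[ℝ] (Plane × ℝ)) (x : Plane) : Plane :=
  (M (homVec x)).2⁻¹ • (M (homVec x)).1

theorem continuousOn_homDiv (M : (Plane × ℝ) ≃ₗ[ℝ] (Plane × ℝ)) :
    ContinuousOn (homDiv M) {x | (M (homVec x)).2 ≠ 0} := by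
  have h : Continuous fun x => M (homVec x) :=
    (LinearMap.continuous_of_finiteDimensional M.toLinearMap).comp
      (continuous_id.prodMk continuous_const)
  exact (h.snd.continuousOn.inv₀ fun _ h => h).smul h.fst.continuousOn

theorem homDiv_eq {M : (Plane × ℝ) ≃ₗ[ℝ] (Plane × ℝ)} {x y : Plane} {k : ℝ}
    (h : homVec y = k • M (homVec x)) : (M (homVec x)).2 ≠ 0 ∧ y = homDiv M x := by
  have h1 : y = k • (M (homVec x)).1 := congrArg Prod.fst h
  have h2 : 1 = k * (M (homVec x)).2 := congrArg Prod.snd h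
  have h0 : (M (homVec x)).2 ≠ 0 := by intro h0; simp [h0] at h2
  refine ⟨h0, ?_⟩
  rw [homDiv, h1, eq_inv_of_mul_eq_one_left h2.symm]

theorem exists_affine_form (M : (Plane × ℝ) ≃ₗ[ℝ] (Plane × ℝ)) :
    ∃ (α : ℝ) (v : Plane) (T : Plane →ᵃ[ℝ] Plane), ∀ x : Plane,
      (M (homVec x)).2 = α + inner ℝ v x ∧ (M (homVec x)).1 = T x := by
  have hM : ∀ x, M (homVec x) = M (x, 0) + M (0, 1) := by
    intro x
    rw [← map_add]
    simp [homVec]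
  let g : Plane →ₗ[ℝ] ℝ :=
    LinearMap.snd ℝ Plane ℝ ∘ₗ M.toLinearMap ∘ₗ LinearMap.inl ℝ Plane ℝ
  let g' : Plane →ₗ[ℝ] Plane :=
    LinearMap.fst ℝ Plane ℝ ∘ₗ M.toLinearMap ∘ₗ LinearMap.inl ℝ Plane ℝ
  refine ⟨(M (0, 1)).2, (InnerProductSpace.toDual ℝ Plane).symm (LinearMap.toContinuousLinearMap g),
    g'.toAffineMap + AffineMap.const ℝ Plane (M (0, 1)).1, fun x => ⟨?_, ?_⟩⟩
  · rw [InnerProductSpace.toDual_symm_apply, hM, add_comm]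
    rfl
  · rw [hM]
    rfl

theorem mul_snd_pos_of_convex {G : Set Plane} (hG : Convex ℝ G)
    {M : (Plane × ℝ) ≃ₗ[ℝ] (Plane × ℝ)} (hM : ∀ x ∈ G, (M (homVec x)).2 ≠ 0) {x y : Plane}
    (hx : x ∈ G) (hy : y ∈ G) : 0 < (M (homVec x)).2 * (M (homVec y)).2 := by
  by_contra! h
  have hx0 := abs_pos.2 (hM x hx)
  have hy0 := abs_pos.2 (hM y hy)
  -- If the denominators had opposite signs, these crosswise weights would make them cancel, giving
  -- a point z of G with zero denominator.
  obtain ⟨z, hz, e⟩ := exists_homVec_of_convex hG hx hy hy0.le hx0.le (by positivity)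
  have e' := congrArg (fun w => (M w).2) e
  simp only [map_add, map_smul, Prod.snd_add, Prod.smul_snd, smul_eq_mul] at e'
  refine mul_ne_zero (by positivity) (hM z hz) (e'.symm.trans ?_)
  rcases lt_or_gt_of_ne (hM x hx) with h1 | h1 <;> rcases lt_or_gt_of_ne (hM y hy) with h2 | h2
  · nlinarith
  · rw [abs_of_neg h1, abs_of_pos h2]; ring
  · rw [abs_of_pos h1, abs_of_neg h2]; ring
  · nlinarith

theorem mainTheorem2 (G : Set Plane) (hG : Convex ℝ G) (f : G → Plane)
    (hf : BtwMonotone f)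
    (hint : ∃ a b c d : G, f d ∈ interior (convexHull ℝ {f a, f b, f c})) :
    -- `f` is the restriction of a unique homography,
    (∃! φ : ProjPlane → ProjPlane,
      IsHomography φ ∧ ∀ x : G, φ (toProj x) = toProj (f x)) ∧
    -- which in affine coordinates is a quotient of an affine mapping by an affine functional,
    (∃ (α : ℝ) (v : Plane) (T : Plane →ᵃ[ℝ] Plane), ∀ x : G,
      α + inner ℝ v (x : Plane) ≠ 0 ∧
        f x = (1 / (α + inner ℝ v (x : Plane))) • T (x : Plane)) ∧
    -- and `f` is a homeomorphism and a monotone isomorphism onto its image.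
    (∃ e : G ≃ₜ Set.range f, (∀ x : G, (e x : Plane) = f x) ∧
      BtwMonotone (fun x : G => (e x : Plane)) ∧
        BtwMonotone (fun y : Set.range f => (e.symm y : Plane))) := by
  obtain ⟨⟨B, hB⟩, M, hM⟩ := hf.exists_linearEquiv hG hint
  have hne : ∀ x : G, (M (homVec x)).2 ≠ 0 := fun x => (homDiv_eq (hM x).choose_spec.2).1
  have hfM : ∀ x : G, f x = homDiv M x := fun x => (homDiv_eq (hM x).choose_spec.2).2
  have hsymm : ∀ x : G, homVec x = (M (homVec x)).2 • M.symm (homVec (f x)) := by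
    intro x
    rw [← map_smul, LinearEquiv.eq_symm_apply, hfM]
    refine Prod.ext ?_ ?_
    · exact (smul_inv_smul₀ (hne x) _).symm
    · simp [homVec]
  refine ⟨⟨_, ⟨isHomography_map M, fun x => ?_⟩, ?_⟩, ?_, ?_⟩
  · obtain ⟨k, hk, e⟩ := hM x
    rw [toProj, Projectivization.map_mk]
    refine (Projectivization.mk_eq_mk_iff' ℝ _ _ _ _).2 ⟨k⁻¹, ?_⟩
    change k⁻¹ • homVec (f x) = M (homVec x)
    rw [e, inv_smul_smul₀ hk]
  · rintro ψ ⟨hψ, hψ'⟩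
    refine hψ.eq_of_eqOn hB (isHomography_map M) fun x => ?_
    rw [hψ']
    obtain ⟨k, hk, e⟩ := hM x
    rw [toProj, toProj, Projectivization.map_mk]
    exact (Projectivization.mk_eq_mk_iff' ℝ _ _ _ _).2 ⟨k, e.symm⟩
  · obtain ⟨α, v, T, h⟩ := exists_affine_form M
    refine ⟨α, v, T, fun x => ?_⟩
    rw [← (h x).1, ← (h x).2, one_div]
    exact ⟨hne x, hfM x⟩
  · have hinj : Function.Injective f := by
      intro x y hxy
      have h := hsymm x
      have h' := hsymm y
      rw [← hxy, ← inv_smul_eq_iff₀ (hne y)] at h'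
      rw [← h', ← one_smul ℝ (homVec x), smul_smul] at h
      exact Subtype.ext (smul_homVec_inj one_ne_zero h)
    have hcont : Continuous f := by
      have : f = G.domRestrict (homDiv M) := funext hfM
      rw [this]
      exact ((continuousOn_homDiv M).mono fun x hx => hne ⟨x, hx⟩).domRestrict
    let e := Equiv.ofInjective f hinj
    have hf_symm : ∀ y : Set.range f, f (e.symm y) = y := Equiv.apply_ofInjective_symm hinj
    have hcont' : Continuous e.symm := by
      rw [continuous_induced_rng]
      have : ((↑) ∘ e.symm : Set.range f → Plane) = (Set.range f).domRestrict (homDiv M.symm) := by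
        funext y
        have := (homDiv_eq (hsymm (e.symm y))).2
        rwa [hf_symm] at this
      rw [this]
      refine ((continuousOn_homDiv M.symm).mono ?_).domRestrict
      rintro _ ⟨x, rfl⟩
      exact (homDiv_eq (hsymm x)).1
    refine ⟨⟨e, hcont.subtype_mk _, hcont'⟩, fun x => rfl, hf, ?_⟩
    rintro ⟨_, a, rfl⟩ ⟨_, x, rfl⟩ ⟨_, b, rfl⟩ h
    have hsx : ∀ x, e.symm ⟨f x, x, rfl⟩ = x := Equiv.ofInjective_symm_apply hinj
    change Wbtw ℝ (e.symm ⟨f a, a, rfl⟩ : Plane) (e.symm ⟨f x, x, rfl⟩) (e.symm ⟨f b, b, rfl⟩)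
    rw [hsx, hsx, hsx]
    obtain ⟨r, s, hr, hs, h⟩ := Wbtw.exists_homVec h
    -- Pulling back by `M.symm` multiplies the two weights by quotients of denominators; the
    -- constant sign keeps the combination conic.
    have hpos : ∀ y : G, 0 < (M (homVec x)).2 * (M (homVec y)).2 := fun y =>
      mul_snd_pos_of_convex hG (fun z hz => hne ⟨z, hz⟩) x.2 y.2
    have hy : ∀ y : G, M.symm (homVec (f y)) = (M (homVec y)).2⁻¹ • homVec y := fun y =>
      (eq_inv_smul_iff₀ (hne y)).2 (hsymm y).symm
    have hquot : ∀ y : G, 0 ≤ (M (homVec x)).2 * (M (homVec y)).2⁻¹ := fun y => by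
      rw [← div_eq_mul_inv, ← mul_div_mul_right _ _ (hne y)]
      exact div_nonneg (hpos y).le (mul_self_nonneg _)
    refine wbtw_of_smul_homVec one_pos (mul_nonneg hr (hquot a)) (mul_nonneg hs (hquot b)) ?_
    refine (one_smul ℝ _).trans ((hsymm x).trans ?_)
    rw [h, map_add, map_smul, map_smul, hy, hy]
    module
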